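/- Let $\Theta=\{\theta_0<\dots<\theta_{M-1}\}$ ($M\ge 2$) be a finite totally ordered set of seller qualities and $Y$ a finite totally ordered rating scale with at least two ratings. For each $\theta\in\Theta$ let $\rho(\theta,\cdot\,|Y)$ be a probability distribution on $Y$, and put $R(\theta,y|Y)=\sum_{y'\ge y}\rho(\theta,y'|Y)$. Assume that $R(\theta,y|Y)$ is strictly increasing in $\theta$ for every $y$ other than the lowest rating, and strictly decreasing in $y$ for every $\theta$. Let $\phi:Y\to[0,1]$ be strictly increasing and $g:\Theta\to(0,\infty)$ nondecreasing. For each $\theta\in\Theta$ let $y_0(\theta),y_1(\theta),\dots$ be ratings with distribution $\rho(\theta,\cdot\,|Y)$, all ratings (of all types) being independent. For $k=0,1,2,\dots$ let $n_k(\theta)=\lfloor k\,g(\theta)\rfloor$ and $$x_k(\theta)=\frac1{n_k(\theta)}\sum_{\ell=0}^{n_k(\theta)-1}\phi(y_\ell(\theta)),\qquad x_k(\theta)=0\ \text{ if } n_k(\theta)=0 .$$ Let $$W_k=\frac{2}{M(M-1)}\sum_{\theta>\theta'}\Big(\mathbb P\big(x_k(\theta)>x_k(\theta')\big)-\mathbb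 P\big(x_k(\theta)<x_k(\theta')\big)\Big),$$ the sum being over all pairs $\theta,\theta'\in\Theta$ with $\theta>\theta'$. Let $\Lambda(z|\theta)=\log\sum_{y\in Y}\rho(\theta,y|Y)\exp(z\phi(y))$ and $I(a|\theta)=\sup_{z\in\mathbb R}\{za-\Lambda(z|\theta)\}\in[0,\infty]$. Then $W_k<1$ for all sufficiently large $k$, and $W_k\to1$ exponentially fast: the limit $r=-\lim_{k\to\infty}\frac1k\log(1-W_k)$ exists, is finite and strictly positive, and $$r=\min_{0\le i<M-1}\ \inf_{a\in\mathbb R}\big\{g(\theta_{i+1})\,I(a|\theta_{i+1})+g(\theta_i)\,I(a|\theta_i)\big\}.$$ -/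

import Mathlib

open MeasureTheory ProbabilityTheory Filter Topology

noncomputable section

/-- The primitives of the rating model: a finite totally ordered set `Θ` of seller qualities, a
finite totally ordered rating scale `Y`, the rating probabilities `ρ θ y`, the score function `φ`
and the match function `g`. -/
structure RatingModel (Θ Y : Type*) [LinearOrder Θ] [Fintype Θ] [LinearOrder Y] [Fintype Y] where
  /-- `ρ θ y` is the probability that a seller of type `θ` receives the rating `y`. -/
  ρ : Θ → Y → ℝ
  ρ_nonneg : ∀ θ y, 0 ≤ ρ θ y
  ρ_sum : ∀ θ, ∑ y, ρ θ y = 1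
  /-- A better seller is strictly more likely to be rated `y` or higher. The lowest rating is
  exempt, since every rating is at least the lowest one. -/
  upper_strictMono : ∀ y, ¬ IsMin y →
    StrictMono fun θ => ∑ y' ∈ Finset.univ.filter (fun y' => y ≤ y'), ρ θ y'
  /-- The probability of being rated `y` or higher is strictly decreasing in `y`. -/
  upper_strictAnti : ∀ θ,
    StrictAnti fun y => ∑ y' ∈ Finset.univ.filter (fun y' => y ≤ y'), ρ θ y'
  /-- The score attached to a rating. -/
  φ : Y → ℝ
  φ_mem : ∀ y, φ y ∈ Set.Icc (0 : ℝ) 1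
  φ_strictMono : StrictMono φ
  /-- The match function: the rate at which a seller of type `θ` accumulates ratings. -/
  g : Θ → ℝ
  g_pos : ∀ θ, 0 < g θ
  g_mono : Monotone g

namespace RatingModel

variable {Θ Y Ω : Type*} [LinearOrder Θ] [Fintype Θ] [LinearOrder Y] [Fintype Y]

/-- The number `⌊k g(θ)⌋` of ratings a seller of type `θ` has received up to time `k`. -/
def numRatings (m : RatingModel Θ Y) (k : ℕ) (θ : Θ) : ℕ := ⌊(k : ℝ) * m.g θ⌋₊

/-- `y θ ℓ` is the `ℓ`-th rating received by the seller of type `θ`: all ratings are independent,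
and those of the seller of type `θ` have distribution `ρ θ`. -/
structure GeneratesRatings [MeasurableSpace Y] [MeasurableSpace Ω] (m : RatingModel Θ Y)
    (P : Measure Ω) (y : Θ → ℕ → Ω → Y) : Prop where
  measurable : ∀ θ l, Measurable (y θ l)
  indep : iIndepFun (fun q : Θ × ℕ => y q.1 q.2) P
  law : ∀ θ l v, P.real {ω | y θ l ω = v} = m.ρ θ v

/-- The aggregate score at time `k` of the seller of type `θ`: the average of the scores of the
ratings received so far, and `0` if there are none. -/
def score (m : RatingModel Θ Y) (y : Θ → ℕ → Ω → Y) (k : ℕ) (θ : Θ) (ω : Ω) : ℝ :=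
  (∑ l ∈ Finset.range (m.numRatings k θ), m.φ (y θ l ω)) / (m.numRatings k θ : ℝ)

/-- The probability that the sellers of types `θ₁` and `θ₂` are ranked `θ₁` above `θ₂` at time `k`,
minus the probability that they are ranked the other way round. -/
def pairObjective [MeasurableSpace Ω] (m : RatingModel Θ Y) (P : Measure Ω) (y : Θ → ℕ → Ω → Y)
    (k : ℕ) (θ₁ θ₂ : Θ) : ℝ :=
  P.real {ω | m.score y k θ₂ ω < m.score y k θ₁ ω} -
    P.real {ω | m.score y k θ₁ ω < m.score y k θ₂ ω}

/-- The scaled Kendall tau objective at time `k`. -/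
def objective [MeasurableSpace Ω] (m : RatingModel Θ Y) (P : Measure Ω) (y : Θ → ℕ → Ω → Y)
    (k : ℕ) : ℝ :=
  2 / ((Fintype.card Θ : ℝ) * ((Fintype.card Θ : ℝ) - 1)) *
    ∑ q ∈ (Finset.univ : Finset (Θ × Θ)).filter (fun q => q.2 < q.1),
      m.pairObjective P y k q.1 q.2

/-- The log moment generating function of the score of a single rating of a type `θ` seller. -/
def logMgf (m : RatingModel Θ Y) (θ : Θ) (z : ℝ) : ℝ :=
  Real.log (∑ y, m.ρ θ y * Real.exp (z * m.φ y))

/-- The Legendre transform of `logMgf`; it may be `+∞`. -/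
def rateFun (m : RatingModel Θ Y) (θ : Θ) (a : ℝ) : EReal :=
  ⨆ z : ℝ, ((z * a - m.logMgf θ z : ℝ) : EReal)

/-- The large deviations rate of a pair of types. -/
def pairRate (m : RatingModel Θ Y) (θ θ' : Θ) : EReal :=
  ⨅ a : ℝ, ((m.g θ' : EReal) * m.rateFun θ' a + (m.g θ : EReal) * m.rateFun θ a)

end RatingModel

end

/-! Up to a factor of 2, `1 - W_k` is the average over pairs `θ < θ'` of the probability that `θ'`
is not ranked strictly above `θ`, so the slowest pair sets the rate. For one pair put `D_k = k
(x_k(θ) - x_k(θ'))`. By independence `(1/k) log E exp(s D_k)` tends to `F(s) = g(θ) Λ(s/g(θ)|θ) +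
g(θ') Λ(-s/g(θ')|θ')` (`pairLogMgf`), and Chernoff bounds the exponential growth rate of `P(D_k ≥
0)` by `F(s)` for each `s ≥ 0`.

For the matching lower bound, `F'(0) < 0` because the better type has the larger mean score. If `θ`
can receive a rating above the lowest, `F` tends to infinity, and tilting slightly to the right of
its last minimizer works (`eventually_exp_le_measure_nonneg`). Otherwise `F` only approaches its
infimum, and the event that `θ'` receives nothing but lowest ratings has the right probability
(`exp_le_measure_of_lowest`).

Fenchel–Young gives `-F(s) ≤ pairRate`, with equality where the tilted means agree, that is where
`F'(s) = 0`. Finally, for `s ≥ 0`, raising `θ'` can only lower `F(s)` (`pairLogMgf_antitone`), so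
adjacent pairs suffice. -/

section ExponentialRates

/-! ### Exponential rates and half-line large deviation bounds -/

theorem eventually_const_mul_le_exp {M : ℕ → ℝ} {F b C : ℝ} (hM : ∀ k, 0 < M k) (hC : 0 < C)
    (hF : Tendsto (fun k : ℕ => Real.log (M k) / k) atTop (𝓝 F)) (hb : F < b) :
    ∀ᶠ k : ℕ in atTop, C * M k ≤ Real.exp (k * b) := by
  have hlim : Tendsto (fun k : ℕ => Real.log C / k + Real.log (M k) / k) atTop (𝓝 (0 + F)) :=
    (tendsto_const_div_atTop_nhds_zero_nat _).add hF
  rw [zero_add] at hlim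
  filter_upwards [hlim.eventually (gt_mem_nhds hb), eventually_gt_atTop 0] with k hk hk0
  have hk' : (0 : ℝ) < k := by exact_mod_cast hk0
  rw [← add_div, div_lt_iff₀ hk', ← Real.log_mul hC.ne' (hM k).ne'] at hk
  rw [← Real.log_le_iff_le_exp (mul_pos hC (hM k))]
  linarith

theorem eventually_exp_le_const_mul {M : ℕ → ℝ} {F b C : ℝ} (hM : ∀ k, 0 < M k) (hC : 0 < C)
    (hF : Tendsto (fun k : ℕ => Real.log (M k) / k) atTop (𝓝 F)) (hb : b < F) :
    ∀ᶠ k : ℕ in atTop, Real.exp (k * b) ≤ C * M k := by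
  have hlim : Tendsto (fun k : ℕ => Real.log C / k + Real.log (M k) / k) atTop (𝓝 (0 + F)) :=
    (tendsto_const_div_atTop_nhds_zero_nat _).add hF
  rw [zero_add] at hlim
  filter_upwards [hlim.eventually (lt_mem_nhds hb), eventually_gt_atTop 0] with k hk hk0
  have hk' : (0 : ℝ) < k := by exact_mod_cast hk0
  rw [← add_div, lt_div_iff₀ hk', ← Real.log_mul hC.ne' (hM k).ne'] at hk
  rw [← Real.le_log_iff_exp_le (mul_pos hC (hM k))]
  linarith

theorem tendsto_log_exp_mul_div (b : ℝ) :
    Tendsto (fun k : ℕ => Real.log (Real.exp (k * b)) / k) atTop (𝓝 b) := by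
  refine tendsto_const_nhds.congr' ?_
  filter_upwards [eventually_gt_atTop 0] with k hk
  have hk' : (k : ℝ) ≠ 0 := by exact_mod_cast hk.ne'
  rw [Real.log_exp, mul_div_cancel_left₀ _ hk']

theorem tendsto_neg_inv_mul_log {M : ℕ → ℝ} {r : ℝ}
    (hlow : ∀ b, r < b → ∀ᶠ k : ℕ in atTop, Real.exp (k * -b) ≤ M k)
    (hupp : ∀ b, b < r → ∀ᶠ k : ℕ in atTop, M k ≤ Real.exp (k * -b)) :
    Tendsto (fun k : ℕ => -((1 / (k : ℝ)) * Real.log (M k))) atTop (𝓝 r) := by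
  have hpos : ∀ᶠ k : ℕ in atTop, 0 < M k := by
    filter_upwards [hlow (r + 1) (by linarith)] with k hk
    exact (Real.exp_pos _).trans_le hk
  rw [tendsto_order]
  constructor
  · intro b hb
    obtain ⟨c, hbc, hcr⟩ := exists_between hb
    filter_upwards [hupp c hcr, hpos, eventually_gt_atTop 0] with k hk h0 hk0
    have hk' : (0 : ℝ) < k := by exact_mod_cast hk0
    rw [← Real.log_le_iff_le_exp h0] at hk
    rw [one_div_mul_eq_div, lt_neg, div_lt_iff₀ hk']
    nlinarith
  · intro b hb
    obtain ⟨c, hrc, hcb⟩ := exists_between hb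
    filter_upwards [hlow c hrc, hpos, eventually_gt_atTop 0] with k hk h0 hk0
    have hk' : (0 : ℝ) < k := by exact_mod_cast hk0
    rw [← Real.le_log_iff_exp_le h0] at hk
    rw [one_div_mul_eq_div, neg_lt, lt_div_iff₀ hk']
    nlinarith

variable {Ω : Type*} [MeasurableSpace Ω] {P : Measure Ω} [IsProbabilityMeasure P]

/-- The Gärtner–Ellis lower bound for the half-line `[0, ∞)`: the values `s₀ < s < s₁` of the
limiting log moment generating function locate the mass of the exponentially tilted law in
`[0, k c]`. -/
theorem eventually_exp_le_measure_nonneg {D : ℕ → Ω → ℝ} (hD : ∀ k, Measurable (D k))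
    (hint : ∀ k s, Integrable (fun ω => Real.exp (s * D k ω)) P) {F : ℝ → ℝ}
    (hF : ∀ s, Tendsto (fun k : ℕ => Real.log (mgf (D k) P s) / k) atTop (𝓝 (F s)))
    {s₀ s s₁ c b : ℝ} (hs : 0 ≤ s) (h0 : s₀ < s) (h1 : s < s₁) (hF0 : F s₀ < F s)
    (hF1 : F s₁ - (s₁ - s) * c < F s) (hb : b < F s - s * c) :
    ∀ᶠ k : ℕ in atTop, Real.exp (k * b) ≤ P.real {ω | 0 ≤ D k ω} := by
  have hpos : ∀ k s, 0 < mgf (D k) P s := fun k s => mgf_pos (hint k s)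
  have key : ∀ k : ℕ, mgf (D k) P s ≤ mgf (D k) P s₀ +
      Real.exp (k * (-((s₁ - s) * c))) * mgf (D k) P s₁ +
      -- The three terms dominate `exp (s D)` on `D < 0`, on `D ≥ k c` and on `0 ≤ D ≤ k c`
      -- respectively.
      Real.exp (k * (s * c)) * P.real {ω | 0 ≤ D k ω} := by
    intro k
    have hms : MeasurableSet {ω | 0 ≤ D k ω} := measurableSet_le measurable_const (hD k)
    have hind : Integrable ({ω | 0 ≤ D k ω}.indicator (fun _ => (1 : ℝ))) P :=
      (integrable_const _).indicator hms
    have hI : P.real {ω | 0 ≤ D k ω} = ∫ ω, {ω | 0 ≤ D k ω}.indicator (fun _ => (1 : ℝ)) ω ∂P := by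
      rw [integral_indicator hms]; simp
    have hsum : Integrable (fun ω => Real.exp (s₀ * D k ω) +
        Real.exp (k * (-((s₁ - s) * c))) * Real.exp (s₁ * D k ω)) P :=
      (hint k s₀).add ((hint k s₁).const_mul _)
    rw [hI]
    unfold mgf
    rw [← integral_const_mul, ← integral_const_mul,
      ← integral_add (hint k s₀) ((hint k s₁).const_mul _),
      ← integral_add hsum (hind.const_mul _)]
    refine integral_mono (hint k s) (hsum.add (hind.const_mul _)) fun ω => ?_
    simp only
    have e0 := Real.exp_pos (s₀ * D k ω)
    have e1 : 0 < Real.exp (k * (-((s₁ - s) * c))) * Real.exp (s₁ * D k ω) := by positivity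
    by_cases hneg : D k ω < 0
    · have hω : ω ∉ {ω | 0 ≤ D k ω} := by simpa using hneg
      have : Real.exp (s * D k ω) ≤ Real.exp (s₀ * D k ω) := Real.exp_le_exp.2 (by nlinarith)
      simp only [Set.indicator_of_notMem hω, mul_zero]
      linarith
    · have hω : ω ∈ {ω | 0 ≤ D k ω} := by simpa using hneg
      simp only [Set.indicator_of_mem hω, mul_one]
      have e2 := Real.exp_pos (k * (s * c))
      rcases le_total (D k ω) (k * c) with hle | hge
      · have : Real.exp (s * D k ω) ≤ Real.exp (k * (s * c)) :=
          Real.exp_le_exp.2 (by nlinarith)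
        linarith
      · have : Real.exp (s * D k ω) ≤
            Real.exp (k * (-((s₁ - s) * c))) * Real.exp (s₁ * D k ω) := by
          rw [← Real.exp_add]
          exact Real.exp_le_exp.2 (by nlinarith)
        linarith
  -- The left side of `key` eventually exceeds `exp (k d)`, while each of the first two terms is at
  -- most a quarter of it; the half left for the last term still beats `exp (k (b + s c))`.
  obtain ⟨d, hd, hdF⟩ : ∃ d, max (max (F s₀) (F s₁ - (s₁ - s) * c)) (b + s * c) < d ∧ d < F s :=
    exists_between (max_lt (max_lt hF0 hF1) (by linarith))
  have hd0 := (le_max_left _ _).trans_lt ((le_max_left _ _).trans_lt hd)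
  have hd1 := (le_max_right _ _).trans_lt ((le_max_left _ _).trans_lt hd)
  have hd2 := (le_max_right _ _).trans_lt hd
  filter_upwards [eventually_const_mul_le_exp (fun k => hpos k s₀) (by norm_num : (0 : ℝ) < 4)
      (hF s₀) hd0,
    eventually_const_mul_le_exp (fun k => hpos k s₁) (by norm_num : (0 : ℝ) < 4) (hF s₁)
      (by linarith : F s₁ < d + (s₁ - s) * c),
    eventually_exp_le_const_mul (fun k => hpos k s) one_pos (hF s) hdF,
    eventually_const_mul_le_exp (fun k => Real.exp_pos _) (by norm_num : (0 : ℝ) < 2)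
      (tendsto_log_exp_mul_div (b + s * c)) hd2] with k ha hb' hc hd'
  have hk := key k
  have hb2 : Real.exp (k * (-((s₁ - s) * c))) * (4 * mgf (D k) P s₁) ≤ Real.exp (k * d) := by
    calc _ ≤ Real.exp (k * (-((s₁ - s) * c))) * Real.exp (k * (d + (s₁ - s) * c)) := by gcongr
      _ = Real.exp (k * d) := by rw [← Real.exp_add]; ring_nf
  have hfin : Real.exp (k * (b + s * c)) ≤ Real.exp (k * (s * c)) * P.real {ω | 0 ≤ D k ω} := by
    linarith
  rw [mul_add, Real.exp_add, mul_comm] at hfin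
  exact le_of_mul_le_mul_left hfin (Real.exp_pos _)

theorem eventually_measure_nonneg_le_exp {D : ℕ → Ω → ℝ}
    (hint : ∀ k s, Integrable (fun ω => Real.exp (s * D k ω)) P) {F : ℝ → ℝ}
    (hF : ∀ s, Tendsto (fun k : ℕ => Real.log (mgf (D k) P s) / k) atTop (𝓝 (F s)))
    {s b C : ℝ} (hC : 0 < C) (hs : 0 ≤ s) (hb : F s < b) :
    ∀ᶠ k : ℕ in atTop, C * P.real {ω | 0 ≤ D k ω} ≤ Real.exp (k * b) := by
  filter_upwards [eventually_const_mul_le_exp (fun k => mgf_pos (hint k s)) hC (hF s) hb] with k hk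
  have := measure_ge_le_exp_mul_mgf (μ := P) (X := D k) 0 hs (hint k s)
  simp only [mul_zero, Real.exp_zero, one_mul] at this
  exact (mul_le_mul_of_nonneg_left this hC.le).trans hk

end ExponentialRates

/-! ### Log moment generating functions and convex duality -/

namespace RatingModel

variable {Θ Y Ω : Type*} [LinearOrder Θ] [Fintype Θ] [LinearOrder Y] [Fintype Y]
  (m : RatingModel Θ Y)

theorem sum_exp_pos (θ : Θ) (z : ℝ) : 0 < ∑ y, m.ρ θ y * Real.exp (z * m.φ y) := by
  have hnn : ∀ y ∈ Finset.univ, 0 ≤ m.ρ θ y * Real.exp (z * m.φ y) :=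
    fun y _ => mul_nonneg (m.ρ_nonneg θ y) (Real.exp_pos _).le
  refine (Finset.sum_nonneg hnn).lt_of_ne' fun h => ?_
  rw [Finset.sum_eq_zero_iff_of_nonneg hnn] at h
  have : ∑ y, m.ρ θ y = 0 := Finset.sum_eq_zero fun y hy => by
    simpa [Real.exp_ne_zero] using h y hy
  rw [m.ρ_sum] at this
  exact one_ne_zero this

theorem exp_logMgf (θ : Θ) (z : ℝ) :
    Real.exp (m.logMgf θ z) = ∑ y, m.ρ θ y * Real.exp (z * m.φ y) :=
  Real.exp_log (m.sum_exp_pos θ z)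

@[simp] theorem logMgf_zero (θ : Θ) : m.logMgf θ 0 = 0 := by
  simp [logMgf, m.ρ_sum]

/-- The derivative of `logMgf`, the mean score under the exponentially tilted rating law. -/
noncomputable def tiltedMean (θ : Θ) (z : ℝ) : ℝ :=
  (∑ y, m.ρ θ y * (Real.exp (z * m.φ y) * m.φ y)) / ∑ y, m.ρ θ y * Real.exp (z * m.φ y)

theorem hasDerivAt_logMgf (θ : Θ) (z : ℝ) :
    HasDerivAt (m.logMgf θ) (m.tiltedMean θ z) z := by
  have h : HasDerivAt (fun z => ∑ y, m.ρ θ y * Real.exp (z * m.φ y))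
      (∑ y, m.ρ θ y * (Real.exp (z * m.φ y) * m.φ y)) z := by
    refine HasDerivAt.fun_sum fun y _ => HasDerivAt.const_mul _ ?_
    simpa using ((hasDerivAt_id z).mul_const (m.φ y)).exp
  exact h.log (m.sum_exp_pos θ z).ne'

theorem continuous_logMgf (θ : Θ) : Continuous (m.logMgf θ) :=
  continuous_iff_continuousAt.2 fun z => (m.hasDerivAt_logMgf θ z).continuousAt

theorem continuous_tiltedMean (θ : Θ) : Continuous (m.tiltedMean θ) := by
  unfold tiltedMean
  exact Continuous.div (by fun_prop) (by fun_prop) fun z => (m.sum_exp_pos θ z).ne'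

theorem tiltedMean_zero (θ : Θ) : m.tiltedMean θ 0 = ∑ y, m.ρ θ y * m.φ y := by
  simp [tiltedMean, m.ρ_sum]

/-- The supporting line of the convex function `logMgf` at `z₀`. -/
theorem le_logMgf (θ : Θ) (z z₀ : ℝ) :
    m.logMgf θ z₀ + (z - z₀) * m.tiltedMean θ z₀ ≤ m.logMgf θ z := by
  set a := m.tiltedMean θ z₀ with ha
  rw [← Real.exp_le_exp, Real.exp_add, m.exp_logMgf, m.exp_logMgf, Finset.sum_mul]
  -- Jensen for the tilted law: in `exp x ≥ 1 + x` with `x = (z - z₀)(φ y - a)`, the linear term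
  -- averages to zero.
  have hmean : ∑ y, m.ρ θ y * Real.exp (z₀ * m.φ y) * (m.φ y - a) = 0 := by
    have : a * ∑ y, m.ρ θ y * Real.exp (z₀ * m.φ y) =
        ∑ y, m.ρ θ y * (Real.exp (z₀ * m.φ y) * m.φ y) :=
      div_mul_cancel₀ _ (m.sum_exp_pos θ z₀).ne'
    simp only [mul_sub, Finset.sum_sub_distrib, ← Finset.sum_mul]
    rw [mul_comm _ a, this]
    simp [mul_assoc]
  have hterm : ∀ y ∈ Finset.univ, Real.exp ((z - z₀) * a) * (m.ρ θ y * Real.exp (z₀ * m.φ y) +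
      (z - z₀) * (m.ρ θ y * Real.exp (z₀ * m.φ y) * (m.φ y - a))) ≤
      m.ρ θ y * Real.exp (z * m.φ y) := by
    intro y _
    have h1 := Real.add_one_le_exp ((z - z₀) * (m.φ y - a))
    have h2 : Real.exp (z * m.φ y) = Real.exp ((z - z₀) * a) * (Real.exp (z₀ * m.φ y) *
        Real.exp ((z - z₀) * (m.φ y - a))) := by
      rw [← Real.exp_add, ← Real.exp_add]; ring_nf
    rw [h2]
    have h3 : 0 ≤ Real.exp ((z - z₀) * a) * (m.ρ θ y * Real.exp (z₀ * m.φ y)) :=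
      mul_nonneg (Real.exp_pos _).le (mul_nonneg (m.ρ_nonneg θ y) (Real.exp_pos _).le)
    nlinarith [mul_le_mul_of_nonneg_left h1 h3]
  have := Finset.sum_le_sum hterm
  rw [← Finset.mul_sum, Finset.sum_add_distrib, ← Finset.mul_sum, hmean, mul_zero, add_zero,
    mul_comm, Finset.sum_mul] at this
  exact this

theorem le_rateFun (θ : Θ) (a z : ℝ) : ((z * a - m.logMgf θ z : ℝ) : EReal) ≤ m.rateFun θ a :=
  le_iSup (fun z : ℝ => ((z * a - m.logMgf θ z : ℝ) : EReal)) z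

theorem rateFun_tiltedMean (θ : Θ) (z : ℝ) :
    m.rateFun θ (m.tiltedMean θ z) = ((z * m.tiltedMean θ z - m.logMgf θ z : ℝ) : EReal) := by
  refine le_antisymm (iSup_le fun z' => EReal.coe_le_coe_iff.2 ?_) (m.le_rateFun θ _ z)
  nlinarith [m.le_logMgf θ z' z]

/-- The limiting log moment generating function of the score of `θ` minus that of `θ'`. -/
noncomputable def pairLogMgf (θ θ' : Θ) (s : ℝ) : ℝ :=
  m.g θ * m.logMgf θ (s / m.g θ) + m.g θ' * m.logMgf θ' (-s / m.g θ')

@[simp] theorem pairLogMgf_zero (θ θ' : Θ) : m.pairLogMgf θ θ' 0 = 0 := by simp [pairLogMgf]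

theorem hasDerivAt_pairLogMgf (θ θ' : Θ) (s : ℝ) : HasDerivAt (m.pairLogMgf θ θ')
    (m.tiltedMean θ (s / m.g θ) - m.tiltedMean θ' (-s / m.g θ')) s := by
  have h1 : HasDerivAt (fun s => m.g θ * m.logMgf θ (s / m.g θ))
      (m.g θ * (m.tiltedMean θ (s / m.g θ) * (1 / m.g θ))) s :=
    ((m.hasDerivAt_logMgf θ (s / m.g θ)).comp s ((hasDerivAt_id s).div_const _)).const_mul _
  have h2 : HasDerivAt (fun s => m.g θ' * m.logMgf θ' (-s / m.g θ'))
      (m.g θ' * (m.tiltedMean θ' (-s / m.g θ') * (-1 / m.g θ'))) s :=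
    ((m.hasDerivAt_logMgf θ' (-s / m.g θ')).comp s ((hasDerivAt_id s).neg.div_const _)).const_mul _
  refine (h1.add h2).congr_deriv ?_
  have := (m.g_pos θ).ne'
  have := (m.g_pos θ').ne'
  field_simp
  ring

theorem continuous_pairLogMgf (θ θ' : Θ) : Continuous (m.pairLogMgf θ θ') :=
  continuous_iff_continuousAt.2 fun s => (m.hasDerivAt_pairLogMgf θ θ' s).continuousAt

theorem neg_pairLogMgf_le_pairRate (θ θ' : Θ) (s : ℝ) :
    ((-m.pairLogMgf θ θ' s : ℝ) : EReal) ≤ m.pairRate θ θ' := by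
  refine le_iInf fun a => ?_
  have hg := m.g_pos θ
  have hg' := m.g_pos θ'
  refine le_trans (le_of_eq ?_) (add_le_add
    (mul_le_mul_of_nonneg_left (m.le_rateFun θ' a (-s / m.g θ')) (EReal.coe_nonneg.2 hg'.le))
    (mul_le_mul_of_nonneg_left (m.le_rateFun θ a (s / m.g θ)) (EReal.coe_nonneg.2 hg.le)))
  rw [← EReal.coe_mul, ← EReal.coe_mul, ← EReal.coe_add]
  congr 1
  unfold pairLogMgf
  field_simp
  ring

/-- The common tilted mean is taken as `a`: both Legendre suprema are then attained, at `s / g θ`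
and `-s / g θ'`, and the linear terms in `a` cancel. -/
theorem pairRate_le_of_tiltedMean_eq {θ θ' : Θ} {s : ℝ}
    (h : m.tiltedMean θ (s / m.g θ) = m.tiltedMean θ' (-s / m.g θ')) :
    m.pairRate θ θ' ≤ ((-m.pairLogMgf θ θ' s : ℝ) : EReal) := by
  refine (iInf_le _ (m.tiltedMean θ (s / m.g θ))).trans (le_of_eq ?_)
  rw [m.rateFun_tiltedMean θ, h, m.rateFun_tiltedMean θ', ← EReal.coe_mul, ← EReal.coe_mul,
    ← EReal.coe_add]
  congr 1
  have hg := (m.g_pos θ).ne'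
  have hg' := (m.g_pos θ').ne'
  unfold pairLogMgf
  field_simp
  ring

end RatingModel

/-! ### Minimizers of a function decreasing at the origin -/

section Minimizer

theorem HasDerivAt.exists_gt_lt_of_neg {F : ℝ → ℝ} {d s : ℝ} (h : HasDerivAt F d s) (hd : d < 0) :
    ∃ t, s < t ∧ F t < F s := by
  have h1 := (hasDerivWithinAt_iff_tendsto_slope' (s := Set.Ioi s) (by simp)).1 h.hasDerivWithinAt
  obtain ⟨t, ht, hst⟩ := ((h1.eventually (gt_mem_nhds hd)).and self_mem_nhdsWithin).exists
  have hst' : s < t := hst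
  refine ⟨t, hst', ?_⟩
  rw [slope_def_field, div_lt_iff₀ (by linarith)] at ht
  linarith

/-- Choosing the largest minimizer makes `F` strictly larger to its right without any strict
convexity; the tilting argument needs exactly this. -/
theorem exists_last_minimizer {F : ℝ → ℝ} {d : ℝ} (hc : Continuous F) (hF0 : HasDerivAt F d 0)
    (hd : d < 0) (htop : Tendsto F atTop atTop) :
    ∃ s, 0 < s ∧ F s < F 0 ∧ (∀ t, 0 ≤ t → F s ≤ F t) ∧ ∀ t, s < t → F s < F t := by
  obtain ⟨t₁, ht₁, hlt⟩ := hF0.exists_gt_lt_of_neg hd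
  obtain ⟨S, hS⟩ := (htop.eventually (eventually_gt_atTop (F 0))).exists_forall_of_atTop
  have hS0 : t₁ < S := by
    by_contra! h
    exact (hlt.trans (hS t₁ h)).false
  have hsub : ∀ t, 0 ≤ t → F t ≤ F 0 → t ∈ Set.Icc 0 S := fun t h0 h =>
    ⟨h0, by by_contra! h'; exact (h.trans_lt (hS t h'.le)).false⟩
  obtain ⟨u, hu, hmin⟩ := isCompact_Icc.exists_isMinOn (Set.nonempty_Icc.2 (ht₁.trans hS0).le)
    hc.continuousOn
  have huF : F u < F 0 := (hmin ⟨ht₁.le, hS0.le⟩).trans_lt hlt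
  have hmin' : ∀ t, 0 ≤ t → F u ≤ F t := fun t ht => by
    rcases le_total (F t) (F 0) with h | h
    · exact hmin (hsub t ht h)
    · exact huF.le.trans h
  have hcomp : IsCompact (Set.Icc 0 S ∩ {t | F t ≤ F u}) :=
    isCompact_Icc.inter_right (isClosed_le hc continuous_const)
  obtain ⟨s, ⟨hsI, hs⟩, hgr⟩ := hcomp.exists_isGreatest ⟨u, hu, le_refl (F u)⟩
  have hs' : F s ≤ F u := hs
  have hs0 : s ≠ 0 := fun h => by rw [h] at hs'; linarith
  refine ⟨s, lt_of_le_of_ne hsI.1 hs0.symm, hs'.trans_lt huF, fun t ht => hs'.trans (hmin' t ht),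
    fun t ht => ?_⟩
  by_contra! h
  have h' : F t ≤ F u := h.trans hs'
  exact absurd (hgr ⟨hsub t (hsI.1.trans ht.le) (h'.trans huF.le), h'⟩) (not_le.2 ht)

end Minimizer

/-- Abel summation, by removing the minimum `a`: the remaining sum is bounded with the constant `f
a`, then `f a` is lowered to `c` against the nonnegative total of `d`. -/
theorem Finset.mul_sum_le_sum_mul_of_monotone {Y : Type*} [LinearOrder Y] (s : Finset Y)
    (d f : Y → ℝ) (hf : Monotone f) (hd : ∀ a ∈ s, 0 ≤ ∑ y ∈ s.filter (fun y => a ≤ y), d y)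
    (c : ℝ) (hc : ∀ y ∈ s, c ≤ f y) : c * ∑ y ∈ s, d y ≤ ∑ y ∈ s, d y * f y := by
  induction s using Finset.induction_on_min generalizing c with
  | empty => simp
  | insert a s ha ih =>
    have has : a ∉ s := fun h => (ha a h).false
    have htail : ∀ b ∈ s, 0 ≤ ∑ y ∈ s.filter (fun y => b ≤ y), d y := fun b hb => by
      have := hd b (Finset.mem_insert_of_mem hb)
      rwa [Finset.filter_insert, if_neg (not_le.2 (ha b hb))] at this
    have h1 := ih htail (f a) fun y hy => hf (ha y hy).le
    have h2 := hd a (Finset.mem_insert_self a s)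
    rw [Finset.filter_true_of_mem fun y hy => by
      rcases Finset.mem_insert.1 hy with rfl | h
      exacts [le_rfl, (ha y h).le], Finset.sum_insert has] at h2
    have h3 := hc a (Finset.mem_insert_self a s)
    rw [Finset.sum_insert has, Finset.sum_insert has]
    nlinarith [mul_le_mul_of_nonneg_right h3 h2]

/-! ### Stochastic dominance and monotonicity in the types -/

namespace RatingModel

variable {Θ Y Ω : Type*} [LinearOrder Θ] [Fintype Θ] [LinearOrder Y] [Fintype Y]
  (m : RatingModel Θ Y)

theorem ρ_pos_of_isMin [Nontrivial Y] (θ : Θ) {b : Y} (hb : IsMin b) : 0 < m.ρ θ b := by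
  obtain ⟨v, hv⟩ := exists_ne b
  have hbv : ∀ v, b ≤ v := fun v => (le_total b v).elim id fun h => hb h
  obtain ⟨c, hc, -⟩ := exists_covBy_le_of_lt ((hbv v).lt_of_ne hv.symm)
  have h := m.upper_strictAnti θ hc.lt
  have hset : Finset.univ.filter (fun y' => b ≤ y') =
      insert b (Finset.univ.filter (fun y' => c ≤ y')) := by
    ext y'
    simp only [Finset.mem_filter, Finset.mem_univ, true_and, Finset.mem_insert, hbv y', true_iff]
    rcases (hbv y').eq_or_lt with h | h
    · exact Or.inl h.symm
    · exact Or.inr (hc.ge_of_gt h)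
  have hnot : b ∉ Finset.univ.filter (fun y' => c ≤ y') := by simp [hc.lt]
  simp only at h
  rw [hset, Finset.sum_insert hnot] at h
  linarith

theorem sum_ρ_mul_le_of_monotone {θ θ' : Θ} (h : θ ≤ θ') {f : Y → ℝ} (hf : Monotone f) :
    ∑ y, m.ρ θ y * f y ≤ ∑ y, m.ρ θ' y * f y := by
  rcases isEmpty_or_nonempty Y with hY | hY
  · simp
  obtain ⟨b, hb⟩ := Finite.exists_min f
  have := Finset.univ.mul_sum_le_sum_mul_of_monotone (fun y => m.ρ θ' y - m.ρ θ y) f hf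
    (fun a _ => ?_) (f b) fun y _ => hb y
  · simp only [sub_mul, Finset.sum_sub_distrib, m.ρ_sum, sub_self, mul_zero] at this
    linarith
  · rw [Finset.sum_sub_distrib, sub_nonneg]
    by_cases ha : IsMin a
    · have : Finset.univ.filter (fun y => a ≤ y) = Finset.univ :=
        Finset.filter_true_of_mem fun y _ => (le_total a y).elim id fun h => ha h
      simp [this, m.ρ_sum]
    · exact (m.upper_strictMono a ha).monotone h

theorem mean_lt_mean [Nontrivial Y] {θ θ' : Θ} (h : θ < θ') :
    ∑ y, m.ρ θ y * m.φ y < ∑ y, m.ρ θ' y * m.φ y := by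
  obtain ⟨b, hb⟩ := Finite.exists_min (id : Y → Y)
  simp only [id] at hb
  have hbmin : ∀ a, a ≠ b → ¬ IsMin a := fun a ha hmin => ha (le_antisymm (hmin (hb a)) (hb a))
  set d : Y → ℝ := fun y => m.ρ θ' y - m.ρ θ y with hd
  -- The tail of `d` at the lowest rating is zero, so strictness must come from the rest: with `c`
  -- the second lowest rating, the gap is at least `(φ c - φ b) * ∑ y ∈ s, d y`.
  set s : Finset Y := Finset.univ.erase b with hs
  have htail : ∀ a ∈ s, 0 < ∑ y ∈ s.filter (fun y => a ≤ y), d y := fun a ha => by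
    have hab : a ≠ b := Finset.ne_of_mem_erase ha
    have : s.filter (fun y => a ≤ y) = Finset.univ.filter (fun y => a ≤ y) := by
      rw [hs, Finset.filter_erase, Finset.erase_eq_of_notMem]
      simpa using (hb a).lt_of_ne hab.symm
    rw [this, hd, Finset.sum_sub_distrib, sub_pos]
    exact m.upper_strictMono a (hbmin a hab) h
  obtain ⟨v, hv⟩ := exists_ne b
  have hsne : s.Nonempty := ⟨v, Finset.mem_erase.2 ⟨hv, Finset.mem_univ v⟩⟩
  obtain ⟨c, hc, hcmin⟩ := s.exists_min_image id hsne
  simp only [id] at hcmin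
  have hsum : 0 < ∑ y ∈ s, d y := by
    have := htail c hc
    rwa [Finset.filter_true_of_mem hcmin] at this
  have key := s.mul_sum_le_sum_mul_of_monotone d m.φ m.φ_strictMono.monotone
    (fun a ha => (htail a ha).le) (m.φ c) fun y hy => m.φ_strictMono.monotone (hcmin y hy)
  have hφ : m.φ b < m.φ c :=
    m.φ_strictMono ((hb c).lt_of_ne (Finset.ne_of_mem_erase hc).symm)
  have h1 : ∑ y, d y = 0 := by simp [hd, Finset.sum_sub_distrib, m.ρ_sum]
  rw [← Finset.add_sum_erase _ _ (Finset.mem_univ b)] at h1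
  have h2 := Finset.add_sum_erase Finset.univ (fun y => d y * m.φ y) (Finset.mem_univ b)
  have h3 : ∑ y, d y * m.φ y = ∑ y, m.ρ θ' y * m.φ y - ∑ y, m.ρ θ y * m.φ y := by
    simp [hd, sub_mul, Finset.sum_sub_distrib]
  rw [← sub_pos, ← h3, ← h2]
  have h4 : d b = -∑ y ∈ s, d y := by linarith
  simp only [h4]
  nlinarith [mul_pos (sub_pos.2 hφ) hsum]

theorem logMgf_antitone {θ θ' : Θ} (h : θ ≤ θ') {z : ℝ} (hz : z ≤ 0) :
    m.logMgf θ' z ≤ m.logMgf θ z := by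
  refine Real.log_le_log (m.sum_exp_pos θ' z) ?_
  have hmono : Monotone fun y => -Real.exp (z * m.φ y) := fun a b hab =>
    neg_le_neg (Real.exp_le_exp.2 (mul_le_mul_of_nonpos_left (m.φ_strictMono.monotone hab) hz))
  have := m.sum_ρ_mul_le_of_monotone h hmono
  simpa using this

/-- Dominance handles the change of law. The change of `g` uses `p Λ(z) ≤ Λ(p z)` for `p ≥ 1`, from
convexity and `Λ(0) = 0`, with `p = g θ' / g θ ≥ 1`. -/
theorem mul_logMgf_antitone {θ θ' : Θ} (h : θ ≤ θ') {s : ℝ} (hs : 0 ≤ s) :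
    m.g θ' * m.logMgf θ' (-s / m.g θ') ≤ m.g θ * m.logMgf θ (-s / m.g θ) := by
  have hg := m.g_pos θ
  have hg' := m.g_pos θ'
  have h1 := m.logMgf_antitone h (div_nonpos_of_nonpos_of_nonneg (neg_nonpos.2 hs) hg'.le)
  refine (mul_le_mul_of_nonneg_left h1 hg'.le).trans ?_
  set z := -s / m.g θ' with hz
  have hsz : -s / m.g θ = m.g θ' / m.g θ * z := by rw [hz]; field_simp
  have h2 := m.le_logMgf θ (-s / m.g θ) z
  have h3 := m.le_logMgf θ 0 z
  rw [m.logMgf_zero] at h3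
  rw [hsz] at h2 ⊢
  have hp : 1 ≤ m.g θ' / m.g θ := (one_le_div hg).2 (m.g_mono h)
  have h4 : m.g θ' / m.g θ * m.logMgf θ z ≤ m.logMgf θ (m.g θ' / m.g θ * z) := by nlinarith
  have h5 := mul_le_mul_of_nonneg_left h4 hg.le
  rwa [← mul_assoc, mul_div_cancel₀ _ hg.ne'] at h5

theorem pairLogMgf_antitone (θ : Θ) {θ' θ'' : Θ} (h : θ' ≤ θ'') {s : ℝ} (hs : 0 ≤ s) :
    m.pairLogMgf θ θ'' s ≤ m.pairLogMgf θ θ' s :=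
  add_le_add_right (m.mul_logMgf_antitone h hs) _

theorem log_add_le_logMgf (θ : Θ) {v : Y} (hv : 0 < m.ρ θ v) (z : ℝ) :
    Real.log (m.ρ θ v) + z * m.φ v ≤ m.logMgf θ z := by
  rw [← Real.log_exp (z * m.φ v), ← Real.log_mul hv.ne' (Real.exp_pos _).ne']
  refine Real.log_le_log (mul_pos hv (Real.exp_pos _)) ?_
  exact Finset.single_le_sum (f := fun y => m.ρ θ y * Real.exp (z * m.φ y))
    (fun y _ => mul_nonneg (m.ρ_nonneg θ y) (Real.exp_pos _).le) (Finset.mem_univ v)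

/-- Keeping one atom in each moment generating function bounds `pairLogMgf` below by a line of slope
`φ v - φ b > 0`. -/
theorem tendsto_pairLogMgf_atTop {θ θ' : Θ} {v b : Y} (hv : 0 < m.ρ θ v) (hb : 0 < m.ρ θ' b)
    (hbv : b < v) : Tendsto (m.pairLogMgf θ θ') atTop atTop := by
  have hφ : 0 < m.φ v - m.φ b := sub_pos.2 (m.φ_strictMono hbv)
  refine tendsto_atTop_mono (fun s => ?_) (tendsto_atTop_add_const_right atTop
    (m.g θ * Real.log (m.ρ θ v) + m.g θ' * Real.log (m.ρ θ' b)) (tendsto_id.atTop_mul_const hφ))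
  have hg := m.g_pos θ
  have hg' := m.g_pos θ'
  have h1 := mul_le_mul_of_nonneg_left (m.log_add_le_logMgf θ hv (s / m.g θ)) hg.le
  have h2 := mul_le_mul_of_nonneg_left (m.log_add_le_logMgf θ' hb (-s / m.g θ')) hg'.le
  have e1 : m.g θ * (Real.log (m.ρ θ v) + s / m.g θ * m.φ v) =
      m.g θ * Real.log (m.ρ θ v) + s * m.φ v := by field_simp
  have e2 : m.g θ' * (Real.log (m.ρ θ' b) + -s / m.g θ' * m.φ b) =
      m.g θ' * Real.log (m.ρ θ' b) - s * m.φ b := by field_simp; ring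
  rw [e1] at h1
  rw [e2] at h2
  simp only [id, pairLogMgf]
  linarith

theorem pairRate_eq_of_minimizer {θ θ' : Θ} {s : ℝ} (hs : 0 < s)
    (hmin : ∀ t, 0 ≤ t → m.pairLogMgf θ θ' s ≤ m.pairLogMgf θ θ' t) :
    m.tiltedMean θ (s / m.g θ) - m.tiltedMean θ' (-s / m.g θ') = 0 ∧
      m.pairRate θ θ' = ((-m.pairLogMgf θ θ' s : ℝ) : EReal) := by
  have hloc : IsLocalMin (m.pairLogMgf θ θ') s := by
    filter_upwards [lt_mem_nhds hs] with t ht using hmin t ht.le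
  have h0 := hloc.hasDerivAt_eq_zero (m.hasDerivAt_pairLogMgf θ θ' s)
  exact ⟨h0, le_antisymm (m.pairRate_le_of_tiltedMean_eq (sub_eq_zero.1 h0))
    (m.neg_pairLogMgf_le_pairRate θ θ' s)⟩

/-! ### The case where the lower type only receives the lowest rating -/

section Degenerate

variable {θ θ' : Θ} {b : Y}

theorem logMgf_of_ρ_eq_zero (hdeg : ∀ v, v ≠ b → m.ρ θ v = 0) (z : ℝ) :
    m.logMgf θ z = z * m.φ b := by
  have h1 : m.ρ θ b = 1 := by
    rw [← m.ρ_sum θ, Finset.sum_eq_single b (fun v _ hv => hdeg v hv) (by simp)]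
  rw [logMgf, Finset.sum_eq_single b (fun v _ hv => by rw [hdeg v hv, zero_mul]) (by simp), h1,
    one_mul, Real.log_exp]

/-- The deterministic score `φ b` of `θ` recentres the law of `θ'`; every atom above `b` then decays
and only the mass at `b` survives. -/
theorem tendsto_pairLogMgf_of_ρ_eq_zero (hb : ∀ v, b ≤ v) (hpos : 0 < m.ρ θ' b)
    (hdeg : ∀ v, v ≠ b → m.ρ θ v = 0) :
    Tendsto (m.pairLogMgf θ θ') atTop (𝓝 (m.g θ' * Real.log (m.ρ θ' b))) := by
  have hg := m.g_pos θ
  have hg' := m.g_pos θ'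
  have heq : ∀ s, m.g θ' * Real.log (∑ v, m.ρ θ' v *
      Real.exp (-s * ((m.φ v - m.φ b) / m.g θ'))) = m.pairLogMgf θ θ' s := fun s => by
    have : ∑ v, m.ρ θ' v * Real.exp (-s * ((m.φ v - m.φ b) / m.g θ')) =
        Real.exp (s / m.g θ' * m.φ b) * ∑ v, m.ρ θ' v * Real.exp (-s / m.g θ' * m.φ v) := by
      rw [Finset.mul_sum]
      refine Finset.sum_congr rfl fun v _ => ?_
      rw [mul_left_comm, ← Real.exp_add]
      congr 2
      ring
    rw [this, Real.log_mul (Real.exp_pos _).ne' (m.sum_exp_pos θ' _).ne', Real.log_exp,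
      pairLogMgf, m.logMgf_of_ρ_eq_zero hdeg, logMgf]
    field_simp
  refine Tendsto.congr heq (Tendsto.const_mul _ (Tendsto.log ?_ hpos.ne'))
  have hsum : ∑ v, (if v = b then m.ρ θ' b else 0) = m.ρ θ' b := by simp
  rw [← hsum]
  refine tendsto_finsetSum _ fun v _ => ?_
  by_cases hv : v = b
  · simp [hv]
  · have hφ : 0 < (m.φ v - m.φ b) / m.g θ' :=
      div_pos (sub_pos.2 (m.φ_strictMono ((hb v).lt_of_ne (Ne.symm hv)))) hg'
    have := (Real.tendsto_exp_atBot.comp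
      (tendsto_neg_atTop_atBot.atBot_mul_const hφ)).const_mul (m.ρ θ' v)
    simpa [hv] using this

theorem pairRate_le_of_ρ_eq_zero (hpos : 0 < m.ρ θ' b) (hdeg : ∀ v, v ≠ b → m.ρ θ v = 0) :
    m.pairRate θ θ' ≤ ((-(m.g θ' * Real.log (m.ρ θ' b)) : ℝ) : EReal) := by
  refine (iInf_le _ (m.φ b)).trans ?_
  have h1 : m.rateFun θ (m.φ b) ≤ ((0 : ℝ) : EReal) := iSup_le fun z => by
    rw [m.logMgf_of_ρ_eq_zero hdeg, sub_self]
  have h2 : m.rateFun θ' (m.φ b) ≤ ((-Real.log (m.ρ θ' b) : ℝ) : EReal) := iSup_le fun z =>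
    EReal.coe_le_coe_iff.2 (by linarith [m.log_add_le_logMgf θ' hpos z])
  refine (add_le_add
    (mul_le_mul_of_nonneg_left h2 (EReal.coe_nonneg.2 (m.g_pos θ').le))
    (mul_le_mul_of_nonneg_left h1 (EReal.coe_nonneg.2 (m.g_pos θ).le))).trans (le_of_eq ?_)
  rw [← EReal.coe_mul, ← EReal.coe_mul, ← EReal.coe_add]
  simp

theorem ρ_lt_one_of_lt [Nontrivial Y] (hb : ∀ v, b ≤ v) (h : θ < θ') : m.ρ θ' b < 1 := by
  obtain ⟨v, hv⟩ := exists_ne b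
  have hv' : ¬ IsMin v := fun hmin => hv (le_antisymm (hmin (hb v)) (hb v))
  have h1 := m.upper_strictMono v hv' h
  simp only at h1
  have h2 : 0 ≤ ∑ y' ∈ Finset.univ.filter (fun y' => v ≤ y'), m.ρ θ y' :=
    Finset.sum_nonneg fun y _ => m.ρ_nonneg θ y
  have h3 : ∑ y' ∈ Finset.univ.filter (fun y' => v ≤ y'), m.ρ θ' y' ≤
      ∑ y' ∈ Finset.univ.erase b, m.ρ θ' y' := by
    refine Finset.sum_le_sum_of_subset_of_nonneg (fun y hy => ?_) fun y _ _ => m.ρ_nonneg θ' y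
    simp only [Finset.mem_filter, Finset.mem_univ, true_and] at hy
    refine Finset.mem_erase.2 ⟨?_, Finset.mem_univ y⟩
    rintro rfl
    exact hv (le_antisymm hy (hb v))
  have h4 := Finset.add_sum_erase Finset.univ (m.ρ θ') (Finset.mem_univ b)
  rw [m.ρ_sum] at h4
  linarith

end Degenerate

end RatingModel

/-! ### Moment generating functions and probabilities of score gaps -/

namespace RatingModel

variable {Θ Y Ω : Type*} [LinearOrder Θ] [Fintype Θ] [LinearOrder Y] [Fintype Y]
  (m : RatingModel Θ Y) {y : Θ → ℕ → Ω → Y}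

/-- The score of `θ` minus that of `θ'`, scaled by the time. -/
noncomputable def scoreGap (y : Θ → ℕ → Ω → Y) (θ θ' : Θ) (k : ℕ) (ω : Ω) : ℝ :=
  k * (m.score y k θ ω - m.score y k θ' ω)

theorem score_mem_Icc (k : ℕ) (θ : Θ) (ω : Ω) : m.score y k θ ω ∈ Set.Icc (0 : ℝ) 1 := by
  unfold score
  refine ⟨div_nonneg (Finset.sum_nonneg fun l _ => (m.φ_mem _).1) (Nat.cast_nonneg _),
    div_le_one_of_le₀ ?_ (Nat.cast_nonneg _)⟩
  calc _ ≤ ∑ l ∈ Finset.range (m.numRatings k θ), (1 : ℝ) :=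
        Finset.sum_le_sum fun l _ => (m.φ_mem _).2
    _ = _ := by simp

variable {m}

theorem tendsto_numRatings_div (θ : Θ) :
    Tendsto (fun k : ℕ => (m.numRatings k θ : ℝ) / k) atTop (𝓝 (m.g θ)) := by
  have := (tendsto_nat_floor_mul_div_atTop (m.g_pos θ).le).comp
    (tendsto_natCast_atTop_atTop (R := ℝ))
  refine this.congr fun k => ?_
  simp [numRatings, mul_comm]

theorem setOf_scoreGap_nonneg (θ θ' : Θ) {k : ℕ} (hk : 0 < k) :
    {ω | 0 ≤ m.scoreGap y θ θ' k ω} = {ω | m.score y k θ' ω ≤ m.score y k θ ω} := by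
  ext ω
  have hk' : (0 : ℝ) < k := by exact_mod_cast hk
  simp [scoreGap, mul_nonneg_iff_of_pos_left hk']

variable [MeasurableSpace Y] [MeasurableSingletonClass Y] [MeasurableSpace Ω] {P : Measure Ω}

theorem GeneratesRatings.measurable_score (hy : m.GeneratesRatings P y) (k : ℕ) (θ : Θ) :
    Measurable (m.score y k θ) := by
  unfold score
  exact (Finset.measurable_sum _ fun l _ =>
    (Measurable.of_discrete (f := m.φ)).comp (hy.measurable θ l)).div_const _

theorem GeneratesRatings.measurable_scoreGap (hy : m.GeneratesRatings P y) (θ θ' : Θ) (k : ℕ) :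
    Measurable (m.scoreGap y θ θ' k) :=
  ((hy.measurable_score k θ).sub (hy.measurable_score k θ')).const_mul _

variable [IsProbabilityMeasure P]

theorem GeneratesRatings.integrable_exp_scoreGap (hy : m.GeneratesRatings P y) (θ θ' : Θ) (k : ℕ)
    (s : ℝ) : Integrable (fun ω => Real.exp (s * m.scoreGap y θ θ' k ω)) P := by
  refine integrable_exp_mul_of_mem_Icc (a := -k) (b := k)
    (hy.measurable_scoreGap θ θ' k).aemeasurable (ae_of_all _ fun ω => ?_)
  have h1 := m.score_mem_Icc (y := y) k θ ω
  have h2 := m.score_mem_Icc (y := y) k θ' ω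
  have hk : (0 : ℝ) ≤ k := Nat.cast_nonneg k
  unfold scoreGap
  constructor <;> nlinarith [h1.1, h1.2, h2.1, h2.2]

theorem GeneratesRatings.mgf_const_mul_φ (hy : m.GeneratesRatings P y) (θ : Θ) (l : ℕ) (c s : ℝ) :
    mgf (fun ω => c * m.φ (y θ l ω)) P s = Real.exp (m.logMgf θ (s * c)) := by
  have hmap := integral_map (μ := P) (φ := y θ l) (hy.measurable θ l).aemeasurable
    (f := fun v => Real.exp (s * (c * m.φ v))) Measurable.of_discrete.aestronglyMeasurable
  have : IsProbabilityMeasure (P.map (y θ l)) :=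
    Measure.isProbabilityMeasure_map (hy.measurable θ l).aemeasurable
  rw [mgf, ← hmap, integral_fintype Integrable.of_finite, m.exp_logMgf]
  refine Finset.sum_congr rfl fun v _ => ?_
  rw [map_measureReal_apply (hy.measurable θ l) (measurableSet_singleton v), smul_eq_mul,
    ← hy.law θ l v, mul_assoc]
  rfl

/-- The gap is one sum over an independent family indexed by `Θ × ℕ`, with weight `k / n` for `θ`
and `-(k / n')` for `θ'`. A seller without ratings contributes an empty sum, consistent with `k / 0
= 0`. -/
theorem GeneratesRatings.mgf_scoreGap (hy : m.GeneratesRatings P y) {θ θ' : Θ} (hne : θ ≠ θ')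
    (k : ℕ) (s : ℝ) :
    mgf (m.scoreGap y θ θ' k) P s = Real.exp
      (m.numRatings k θ * m.logMgf θ (s * (k / m.numRatings k θ)) +
        m.numRatings k θ' * m.logMgf θ' (s * -(k / m.numRatings k θ'))) := by
  set n := m.numRatings k θ
  set n' := m.numRatings k θ'
  let w : Θ → ℝ := fun t => if t = θ then k / n else -(k / n')
  have hw : w θ = k / n := if_pos rfl
  have hw' : w θ' = -(k / n') := if_neg hne.symm
  let X : Θ × ℕ → Ω → ℝ := fun q ω => w q.1 * m.φ (y q.1 q.2 ω)
  have hX : ∀ q, Measurable (X q) := fun q =>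
    ((Measurable.of_discrete (f := m.φ)).comp (hy.measurable q.1 q.2)).const_mul _
  have hindep : iIndepFun X P :=
    hy.indep.comp (fun q v => w q.1 * m.φ v) fun q => Measurable.of_discrete
  have hdisj : Disjoint (({θ} : Finset Θ) ×ˢ Finset.range n) (({θ'} : Finset Θ) ×ˢ Finset.range n') :=
    Finset.disjoint_product.2 (Or.inl (by simpa using hne))
  have hgap : m.scoreGap y θ θ' k =
      ∑ q ∈ ({θ} : Finset Θ) ×ˢ Finset.range n ∪ ({θ'} : Finset Θ) ×ˢ Finset.range n', X q := by
    ext ω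
    rw [Finset.sum_apply, Finset.sum_union hdisj, Finset.sum_product, Finset.sum_product,
      Finset.sum_singleton, Finset.sum_singleton]
    simp only [X, hw, hw', ← Finset.mul_sum]
    unfold scoreGap score
    ring
  rw [hgap, hindep.mgf_sum hX, Finset.prod_union hdisj, Finset.prod_product, Finset.prod_product,
    Finset.prod_singleton, Finset.prod_singleton]
  simp only [X, hw, hw', hy.mgf_const_mul_φ, Finset.prod_const, Finset.card_range, Real.exp_add,
    Real.exp_nat_mul]

theorem GeneratesRatings.tendsto_log_mgf_scoreGap (hy : m.GeneratesRatings P y) {θ θ' : Θ}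
    (hne : θ ≠ θ') (s : ℝ) :
    Tendsto (fun k : ℕ => Real.log (mgf (m.scoreGap y θ θ' k) P s) / k) atTop
      (𝓝 (m.pairLogMgf θ θ' s)) := by
  have aux : ∀ (t : Θ) (u : ℝ), Tendsto (fun k : ℕ => (m.numRatings k t : ℝ) / k *
      m.logMgf t (u * ((m.numRatings k t : ℝ) / k)⁻¹)) atTop
      (𝓝 (m.g t * m.logMgf t (u * (m.g t)⁻¹))) := fun t u =>
    (tendsto_numRatings_div t).mul (((m.continuous_logMgf t).tendsto _).comp
      (((tendsto_numRatings_div t).inv₀ (m.g_pos t).ne').const_mul u))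
  have h := (aux θ s).add (aux θ' (-s))
  simp only [← div_eq_mul_inv (_ : ℝ) (m.g _)] at h
  refine h.congr fun k => ?_
  rw [hy.mgf_scoreGap hne, Real.log_exp, inv_div, inv_div, neg_mul, mul_neg]
  ring

theorem GeneratesRatings.measure_le_exp (hy : m.GeneratesRatings P y) {θ θ' : Θ}
    (hne : θ ≠ θ') {s b C : ℝ} (hC : 0 < C) (hs : 0 ≤ s) (hb : m.pairLogMgf θ θ' s < b) :
    ∀ᶠ k : ℕ in atTop,
      C * P.real {ω | m.score y k θ' ω ≤ m.score y k θ ω} ≤ Real.exp (k * b) := by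
  filter_upwards [eventually_measure_nonneg_le_exp (hy.integrable_exp_scoreGap θ θ')
    (hy.tendsto_log_mgf_scoreGap hne) hC hs hb, eventually_gt_atTop 0] with k hk hk0
  rwa [setOf_scoreGap_nonneg θ θ' hk0] at hk

/-- All ratings of `θ'` being the lowest one is a way for `θ'` not to be ranked above `θ`. -/
theorem GeneratesRatings.exp_le_measure_of_lowest (hy : m.GeneratesRatings P y) (θ θ' : Θ)
    {v : Y} (hv : ∀ u, v ≤ u) (hpos : 0 < m.ρ θ' v) :
    ∀ᶠ k : ℕ in atTop, Real.exp (k * (m.g θ' * Real.log (m.ρ θ' v))) ≤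
      P.real {ω | m.score y k θ' ω ≤ m.score y k θ ω} := by
  have hev : ∀ t : Θ, ∀ᶠ k : ℕ in atTop, m.numRatings k t ≠ 0 := fun t => by
    filter_upwards [(tendsto_numRatings_div t).eventually (lt_mem_nhds (m.g_pos t))] with k hk h
    simp [h] at hk
  -- An unrated `θ` would score `0`, possibly below `φ v`; an unrated `θ'` does no harm.
  filter_upwards [hev θ] with k hk
  set n' := m.numRatings k θ' with hn'
  have hsub : (⋂ q ∈ (({θ'} : Finset Θ) ×ˢ Finset.range n'), y q.1 q.2 ⁻¹' {v}) ⊆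
      {ω | m.score y k θ' ω ≤ m.score y k θ ω} := by
    intro ω hω
    simp only [Set.mem_iInter, Finset.mem_product, Finset.mem_singleton, Finset.mem_range,
      Set.mem_preimage, Set.mem_singleton_iff, Prod.forall] at hω
    have h1 : m.φ v ≤ m.score y k θ ω := by
      unfold score
      rw [le_div_iff₀ (by exact_mod_cast Nat.pos_of_ne_zero hk)]
      calc m.φ v * m.numRatings k θ = ∑ l ∈ Finset.range (m.numRatings k θ), m.φ v := by
            simp [mul_comm]
        _ ≤ _ := Finset.sum_le_sum fun l _ => m.φ_strictMono.monotone (hv _)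
    have h2 : m.score y k θ' ω ≤ m.φ v := by
      unfold score
      refine div_le_of_le_mul₀ (Nat.cast_nonneg _) (m.φ_mem v).1 ?_
      refine le_of_eq ((Finset.sum_congr rfl fun l hl => ?_).trans
        (by simp [mul_comm] : ∑ l ∈ Finset.range (m.numRatings k θ'), m.φ v = _))
      rw [hω θ' l ⟨rfl, Finset.mem_range.1 hl⟩]
    exact h2.trans h1
  have hprob : P.real (⋂ q ∈ (({θ'} : Finset Θ) ×ˢ Finset.range n'), y q.1 q.2 ⁻¹' {v}) =
      m.ρ θ' v ^ n' := by
    rw [measureReal_def, hy.indep.measure_inter_preimage_eq_mul _ (fun q _ =>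
      measurableSet_singleton v), ENNReal.toReal_prod, Finset.prod_product, Finset.prod_singleton]
    exact (Finset.prod_congr rfl fun l _ => hy.law θ' l v).trans (by simp)
  refine le_trans ?_ (measureReal_mono hsub)
  rw [hprob, ← Real.rpow_natCast, Real.rpow_def_of_pos hpos, Real.exp_le_exp, mul_comm,
    mul_comm (m.g θ'), mul_assoc]
  have hle : m.ρ θ' v ≤ 1 := by
    rw [← m.ρ_sum θ']
    exact Finset.single_le_sum (fun u _ => m.ρ_nonneg θ' u) (Finset.mem_univ v)
  refine mul_le_mul_of_nonpos_left ?_ (Real.log_nonpos hpos.le hle)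
  rw [mul_comm]
  exact Nat.floor_le (mul_nonneg (Nat.cast_nonneg k) (m.g_pos θ').le)

end RatingModel

/-! ### Large deviations rate of a pair -/

namespace RatingModel

variable {Θ Y Ω : Type*} [LinearOrder Θ] [Fintype Θ] [LinearOrder Y] [Fintype Y]
  [MeasurableSpace Y] [MeasurableSingletonClass Y] [MeasurableSpace Ω]
  {P : Measure Ω} [IsProbabilityMeasure P] {m : RatingModel Θ Y} {y : Θ → ℕ → Ω → Y}

theorem GeneratesRatings.eventually_exp_le_measure_of_minimizer (hy : m.GeneratesRatings P y)
    {θ θ' : Θ} (hne : θ ≠ θ') {s b : ℝ} (hs : 0 < s)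
    (hd : m.tiltedMean θ (s / m.g θ) - m.tiltedMean θ' (-s / m.g θ') = 0)
    (hgt : ∀ t, s < t → m.pairLogMgf θ θ' s < m.pairLogMgf θ θ' t)
    (hb : b < m.pairLogMgf θ θ' s) :
    ∀ᶠ k : ℕ in atTop, Real.exp (k * b) ≤
      P.real {ω | m.score y k θ' ω ≤ m.score y k θ ω} := by
  set F := m.pairLogMgf θ θ' with hF
  set F' : ℝ → ℝ := fun t => m.tiltedMean θ (t / m.g θ) - m.tiltedMean θ' (-t / m.g θ') with hF'
  have hFc : Continuous F := m.continuous_pairLogMgf θ θ'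
  have hF'c : Continuous F' :=
    ((m.continuous_tiltedMean θ).comp (continuous_id.div_const _)).sub
      ((m.continuous_tiltedMean θ').comp (continuous_id.neg.div_const _))
  -- The window `[0, k c]` costs `s c`, half of the slack `F s - b`. The tilt is `t > s`, close
  -- enough to `s` that `F' t < c`; the auxiliary points are `s` on the left and `u > t` on the
  -- right.
  obtain ⟨c, hc0, hc⟩ : ∃ c, 0 < c ∧ b < F s - s * c := by
    refine ⟨(F s - b) / (2 * s), div_pos (sub_pos.2 hb) (by positivity), ?_⟩
    have : s * ((F s - b) / (2 * s)) = (F s - b) / 2 := by field_simp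
    rw [this]
    linarith
  have e1 : ∀ᶠ t in 𝓝 s, F' t < c :=
    (hF'c.tendsto s).eventually (gt_mem_nhds (hd.trans_lt hc0))
  have e2 : ∀ᶠ t in 𝓝 s, b < F t - t * c :=
    ((hFc.sub (continuous_id.mul continuous_const)).tendsto s).eventually (lt_mem_nhds hc)
  obtain ⟨t, ⟨ht1, ht2⟩, hst⟩ := (((e1.and e2).filter_mono nhdsWithin_le_nhds).and
    (self_mem_nhdsWithin (s := Set.Ioi s))).exists
  have hst' : s < t := hst
  have hder : HasDerivAt (fun u => F u - u * c) (F' t - c) t := by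
    simpa using (m.hasDerivAt_pairLogMgf θ θ' t).fun_sub ((hasDerivAt_id t).mul_const c)
  obtain ⟨u, htu, hu⟩ := hder.exists_gt_lt_of_neg (sub_neg.2 ht1)
  filter_upwards [eventually_exp_le_measure_nonneg (fun k => hy.measurable_scoreGap θ θ' k)
    (hy.integrable_exp_scoreGap θ θ') (hy.tendsto_log_mgf_scoreGap hne) (hs.trans hst').le hst' htu
    (hgt t hst') (by linarith : F u - (u - t) * c < F t) ht2,
    eventually_gt_atTop 0] with k hk hk0
  rwa [setOf_scoreGap_nonneg θ θ' hk0] at hk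

/-- The large deviations principle for a pair of types. -/
theorem GeneratesRatings.exists_pairRate_eq [Nontrivial Y] (hy : m.GeneratesRatings P y)
    {θ θ' : Θ} (h : θ < θ') : ∃ r : ℝ, 0 < r ∧ m.pairRate θ θ' = (r : EReal) ∧
      (∀ b, b < r → ∃ s, 0 ≤ s ∧ m.pairLogMgf θ θ' s < -b) ∧
      ∀ b, r < b → ∀ᶠ k : ℕ in atTop, Real.exp (k * -b) ≤
        P.real {ω | m.score y k θ' ω ≤ m.score y k θ ω} := by
  obtain ⟨v, hv⟩ := Finite.exists_min (id : Y → Y)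
  simp only [id] at hv
  have hvmin : IsMin v := fun u _ => hv u
  have hpos := m.ρ_pos_of_isMin θ' hvmin
  by_cases hdeg : ∀ u, u ≠ v → m.ρ θ u = 0
  -- Here the infimum of `pairLogMgf` over `s ≥ 0` is approached only as `s → ∞`, so no critical
  -- point is available.
  · have hlim := m.tendsto_pairLogMgf_of_ρ_eq_zero hv hpos hdeg
    have hlog : Real.log (m.ρ θ' v) < 0 := Real.log_neg hpos (m.ρ_lt_one_of_lt hv h)
    have hsup : ∀ b, b < -(m.g θ' * Real.log (m.ρ θ' v)) →
        ∃ s, 0 ≤ s ∧ m.pairLogMgf θ θ' s < -b := fun b hb => by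
      obtain ⟨s, hs, hs0⟩ := ((hlim.eventually (gt_mem_nhds (by linarith :
        m.g θ' * Real.log (m.ρ θ' v) < -b))).and (eventually_ge_atTop 0)).exists
      exact ⟨s, hs0, hs⟩
    refine ⟨-(m.g θ' * Real.log (m.ρ θ' v)), by nlinarith [m.g_pos θ'],
      le_antisymm (m.pairRate_le_of_ρ_eq_zero hpos hdeg) ?_, hsup, fun b hb => ?_⟩
    · refine EReal.ge_of_forall_gt_iff_ge.1 fun b hb => ?_
      obtain ⟨s, -, hs⟩ := hsup b (EReal.coe_lt_coe_iff.1 hb)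
      exact (EReal.coe_le_coe_iff.2 (by linarith)).trans (m.neg_pairLogMgf_le_pairRate θ θ' s)
    · filter_upwards [hy.exp_le_measure_of_lowest θ θ' hv hpos] with k hk
      refine le_trans (Real.exp_le_exp.2 ?_) hk
      exact mul_le_mul_of_nonneg_left (by linarith) (Nat.cast_nonneg k)
  · push Not at hdeg
    obtain ⟨u, huv, hu⟩ := hdeg
    have hd : m.tiltedMean θ (0 / m.g θ) - m.tiltedMean θ' (-0 / m.g θ') < 0 := by
      rw [neg_zero, zero_div, zero_div, m.tiltedMean_zero, m.tiltedMean_zero, sub_neg]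
      exact m.mean_lt_mean h
    obtain ⟨s, hs, hneg, hmin, hgt⟩ := exists_last_minimizer (m.continuous_pairLogMgf θ θ')
      (m.hasDerivAt_pairLogMgf θ θ' 0) hd (m.tendsto_pairLogMgf_atTop
        ((m.ρ_nonneg θ u).lt_of_ne' hu) hpos ((hv u).lt_of_ne huv.symm))
    rw [m.pairLogMgf_zero] at hneg
    obtain ⟨h0, hrate⟩ := m.pairRate_eq_of_minimizer hs hmin
    exact ⟨-m.pairLogMgf θ θ' s, by linarith, hrate, fun b hb => ⟨s, hs.le, by linarith⟩,
      fun b hb => hy.eventually_exp_le_measure_of_minimizer h.ne hs h0 hgt (by linarith)⟩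

theorem GeneratesRatings.one_sub_pairObjective_mem_Icc (hy : m.GeneratesRatings P y) (k : ℕ)
    (θ₁ θ₂ : Θ) : 1 - m.pairObjective P y k θ₁ θ₂ ∈
      Set.Icc (P.real {ω | m.score y k θ₁ ω ≤ m.score y k θ₂ ω})
        (2 * P.real {ω | m.score y k θ₁ ω ≤ m.score y k θ₂ ω}) := by
  have hms := measurableSet_le (hy.measurable_score k θ₁) (hy.measurable_score k θ₂)
  have hcompl : {ω | m.score y k θ₂ ω < m.score y k θ₁ ω} =
      {ω | m.score y k θ₁ ω ≤ m.score y k θ₂ ω}ᶜ := by ext ω; simp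
  have h1 : P.real {ω | m.score y k θ₁ ω < m.score y k θ₂ ω} ≤
      P.real {ω | m.score y k θ₁ ω ≤ m.score y k θ₂ ω} := 
    measureReal_mono (Set.ofPred_subset_ofPred.2 fun ω hω => hω.le)
  have h2 : 0 ≤ P.real {ω | m.score y k θ₁ ω < m.score y k θ₂ ω} := measureReal_nonneg
  unfold pairObjective
  rw [hcompl, probReal_compl_eq_one_sub hms]
  constructor <;> linarith

end RatingModel

/-! ### From pairs to the objective -/

theorem card_filter_snd_lt_fst (Θ : Type*) [LinearOrder Θ] [Fintype Θ] :
    2 * (((Finset.univ : Finset (Θ × Θ)).filter (fun q => q.2 < q.1)).card : ℝ) =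
      (Fintype.card Θ : ℝ) * ((Fintype.card Θ : ℝ) - 1) := by
  have hswap : ((Finset.univ : Finset (Θ × Θ)).filter (fun q => q.1 < q.2)).card =
      ((Finset.univ : Finset (Θ × Θ)).filter (fun q => q.2 < q.1)).card :=
    Finset.card_equiv (Equiv.prodComm Θ Θ) fun q => by simp
  have hunion : (Finset.univ : Finset Θ).offDiag =
      (Finset.univ : Finset (Θ × Θ)).filter (fun q => q.1 < q.2) ∪
        (Finset.univ : Finset (Θ × Θ)).filter (fun q => q.2 < q.1) := by
    ext q
    simp [lt_or_lt_iff_ne]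
  have hdisj : Disjoint ((Finset.univ : Finset (Θ × Θ)).filter (fun q => q.1 < q.2))
      ((Finset.univ : Finset (Θ × Θ)).filter (fun q => q.2 < q.1)) :=
    Finset.disjoint_filter.2 fun q _ h => h.le.not_gt
  have hcard := congrArg Finset.card hunion
  rw [Finset.card_union_of_disjoint hdisj, hswap, Finset.offDiag_card, Finset.card_univ] at hcard
  have := congrArg (Nat.cast (R := ℝ)) hcard
  rw [Nat.cast_sub (Nat.le_mul_self _)] at this
  push_cast at this
  linarith

namespace RatingModel

variable {Θ Y Ω : Type*} [LinearOrder Θ] [Fintype Θ] [LinearOrder Y] [Fintype Y]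
  [MeasurableSpace Ω]

theorem one_sub_objective_eq [Nontrivial Θ] (m : RatingModel Θ Y) (P : Measure Ω)
    (y : Θ → ℕ → Ω → Y) (k : ℕ) : 1 - m.objective P y k =
      (((Finset.univ : Finset (Θ × Θ)).filter (fun q => q.2 < q.1)).card : ℝ)⁻¹ *
        ∑ q ∈ (Finset.univ : Finset (Θ × Θ)).filter (fun q => q.2 < q.1),
          (1 - m.pairObjective P y k q.1 q.2) := by
  have hcard := card_filter_snd_lt_fst Θ
  have h1 : (1 : ℝ) < Fintype.card Θ := by exact_mod_cast Fintype.one_lt_card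
  have h2 : 0 < (Fintype.card Θ : ℝ) * ((Fintype.card Θ : ℝ) - 1) :=
    mul_pos (by linarith) (by linarith)
  rw [objective, ← hcard, Finset.sum_sub_distrib, Finset.sum_const, nsmul_eq_mul, mul_one]
  rw [← hcard] at h2
  have h3 := (pos_of_mul_pos_right h2 zero_le_two).ne'
  field_simp

end RatingModel

theorem theorem1 {Θ Y Ω : Type*} [LinearOrder Θ] [Fintype Θ] [Nontrivial Θ]
    [LinearOrder Y] [Fintype Y] [Nontrivial Y]
    [MeasurableSpace Y] [MeasurableSingletonClass Y]
    [MeasurableSpace Ω] (P : Measure Ω) [IsProbabilityMeasure P]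
    (m : RatingModel Θ Y) (y : Θ → ℕ → Ω → Y) (hy : m.GeneratesRatings P y) :
    (∀ᶠ k : ℕ in atTop, m.objective P y k < 1) ∧
    Tendsto (fun k : ℕ => m.objective P y k) atTop (𝓝 1) ∧
    ∃ r : ℝ, 0 < r ∧
      Tendsto (fun k : ℕ => -((1 / (k : ℝ)) * Real.log (1 - m.objective P y k))) atTop (𝓝 r) ∧
      IsLeast {e : EReal | ∃ θ θ' : Θ, θ ⋖ θ' ∧ e = m.pairRate θ θ'} (r : EReal) := by
  have hpair : ∀ q : Θ × Θ, q.1 < q.2 → ∃ r : ℝ, 0 < r ∧ m.pairRate q.1 q.2 = (r : EReal) ∧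
      (∀ b, b < r → ∃ s, 0 ≤ s ∧ m.pairLogMgf q.1 q.2 s < -b) ∧
      ∀ b, r < b → ∀ᶠ k : ℕ in atTop, Real.exp (k * -b) ≤
        P.real {ω | m.score y k q.2 ω ≤ m.score y k q.1 ω} :=
    fun q hq => hy.exists_pairRate_eq hq
  choose! R hRpos hR hRsup hRlow using hpair
  obtain ⟨q₀, hq₀, hq₀min⟩ : ∃ q₀ : Θ × Θ, q₀.1 ⋖ q₀.2 ∧
      ∀ q : Θ × Θ, q.1 ⋖ q.2 → R q₀ ≤ R q := by
    obtain ⟨a, b, hab⟩ := exists_pair_lt Θ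
    obtain ⟨c, hc, -⟩ := exists_covBy_le_of_lt hab
    exact Set.exists_min_image {q : Θ × Θ | q.1 ⋖ q.2} R (Set.toFinite _) ⟨(a, c), hc⟩
  set S := (Finset.univ : Finset (Θ × Θ)).filter (fun q => q.2 < q.1) with hS
  have hmem : q₀.swap ∈ S := by simpa [hS] using hq₀.lt
  have hN : (0 : ℝ) < S.card := by exact_mod_cast Finset.card_pos.2 ⟨_, hmem⟩
  have hupp : ∀ b, b < R q₀ → ∀ᶠ k : ℕ in atTop, 1 - m.objective P y k ≤ Real.exp (k * -b) := by
    intro b hb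
    have hall : ∀ q ∈ S, ∀ᶠ k : ℕ in atTop, 2 * P.real {ω | m.score y k q.1 ω ≤ m.score y k q.2 ω} ≤
        Real.exp (k * -b) := by
      intro q hq
      have hlt : q.2 < q.1 := (Finset.mem_filter.1 hq).2
      -- The Chernoff parameter of the adjacent pair `(q.2, c)` also serves `(q.2, q.1)`, by
      -- monotonicity in the upper type.
      obtain ⟨c, hc, hcq⟩ := exists_covBy_le_of_lt hlt
      obtain ⟨s, hs, hsb⟩ := hRsup (q.2, c) hc.lt b (hb.trans_le (hq₀min (q.2, c) hc))
      exact hy.measure_le_exp hlt.ne two_pos hs ((m.pairLogMgf_antitone q.2 hcq hs).trans_lt hsb)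
    filter_upwards [(Finset.eventually_all S).2 hall] with k hk
    rw [m.one_sub_objective_eq, inv_mul_le_iff₀ hN, ← nsmul_eq_mul]
    exact Finset.sum_le_card_nsmul _ _ _ fun q hq =>
      (hy.one_sub_pairObjective_mem_Icc k q.1 q.2).2.trans (hk q hq)
  have hlow : ∀ b, R q₀ < b → ∀ᶠ k : ℕ in atTop, Real.exp (k * -b) ≤ 1 - m.objective P y k := by
    intro b hb
    -- The room between `c` and `b` absorbs the factor `1 / S.card` of the average.
    obtain ⟨c, hc, hcb⟩ := exists_between hb
    filter_upwards [hRlow q₀ hq₀.lt c hc, eventually_exp_le_const_mul (fun k => Real.exp_pos _)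
      (inv_pos.2 hN) (tendsto_log_exp_mul_div (-c)) (neg_lt_neg hcb)] with k hk hk'
    rw [m.one_sub_objective_eq]
    refine hk'.trans (mul_le_mul_of_nonneg_left (hk.trans ?_) (inv_pos.2 hN).le)
    refine (hy.one_sub_pairObjective_mem_Icc k q₀.2 q₀.1).1.trans ?_
    have hnn : ∀ q ∈ S, 0 ≤ 1 - m.pairObjective P y k q.1 q.2 := fun q _ =>
      measureReal_nonneg.trans (hy.one_sub_pairObjective_mem_Icc k q.1 q.2).1
    have hsingle := Finset.single_le_sum hnn hmem
    simpa only [Prod.fst_swap, Prod.snd_swap] using hsingle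
  have hpos : ∀ᶠ k : ℕ in atTop, 0 < 1 - m.objective P y k := by
    filter_upwards [hlow (R q₀ + 1) (by linarith)] with k hk
    exact (Real.exp_pos _).trans_le hk
  have hr := hRpos q₀ hq₀.lt
  refine ⟨hpos.mono fun k hk => sub_pos.1 hk, ?_, R q₀, hr, tendsto_neg_inv_mul_log hlow hupp,
    ⟨q₀.1, q₀.2, hq₀, (hR q₀ hq₀.lt).symm⟩, ?_⟩
  · have hexp : Tendsto (fun k : ℕ => Real.exp (k * -(R q₀ / 2))) atTop (𝓝 0)  := by
      refine Real.tendsto_exp_atBot.comp ?_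
      exact (tendsto_natCast_atTop_atTop (R := ℝ)).atTop_mul_const_of_neg (by linarith)
    have hzero := squeeze_zero' (hpos.mono fun k hk => hk.le) (hupp (R q₀ / 2) (by linarith)) hexp
    simpa using hzero.const_sub 1
  · rintro e ⟨θ, θ', hcov, rfl⟩
    rw [hR (θ, θ') hcov.lt]
    exact EReal.coe_le_coe_iff.2 (hq₀min (θ, θ') hcov)
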